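/- Let $p\ge 1$ and $n\ge 0$ be integers; if $p=1$, assume $n\le 1$ (for $p=1$ and $n\ge 2$ the only harmonic homogeneous polynomial of degree $n$ is $0$). Let $S^{p-1}$ be the unit sphere of $\mathbb R^p$ with its surface measure $d\Omega_{p-1}$ and surface area $\Omega_{p-1}$, and let $N(p,n)$ be the dimension of the real vector space of harmonic homogeneous polynomials of degree $n$ in $p$ real variables. A spherical harmonic of degree $n$ is the restriction of such a polynomial to $S^{p-1}$. Let $e=(1,0,\dots,0)\in\mathbb R^p$. A Legendre polynomial $P_n$ of degree $n$ in dimension $p$ is a real polynomial in one variable with $L_n(\xi)=P_n(\langle\xi,e\rangle)$ for all $\xi\in S^{p-1}$, where $L_n$ is a harmonic homogeneous polynomial of degree $n$ such that $L_n(e)=1$ and $L_n(Rx)=L_n(x)$ for all $x\in\mathbb R^p$ and all orthogonal $p\times p$ matrices $R$ with $Re=e$. **Addition Theorem.** Let $Y_{n,1},\dots,Y_{n,N(p,n)}$ be spherical harmonics of degree $n$ with $\int_{S^{p-1}}Y_{n,i}Y_{n,j}\,d\Omega_{p-1}=\delta_{ij}$ for all $i,j$. Then a Legendre polynomial $P_n$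 exists, and every such $P_n$ satisfies, for all $\xi,\eta\in S^{p-1}$, $$P_n(\langle\xi,\eta\rangle)=\frac{\Omega_{p-1}}{N(p,n)}\sum_{j=1}^{N(p,n)}Y_{n,j}(\xi)\,Y_{n,j}(\eta).$$ (For $p\ge 2$ this determines $P_n$; for $p=1$ only its values at $\pm1$ matter.) -/

import Mathlib

/-- The Laplace operator `∑ i, ∂² / ∂xᵢ²` on real polynomials in `p` variables. -/
noncomputable def polyLaplacian (p : ℕ) :
    MvPolynomial (Fin p) ℝ →ₗ[ℝ] MvPolynomial (Fin p) ℝ :=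
  ∑ i : Fin p,
    (MvPolynomial.pderiv i).toLinearMap ∘ₗ (MvPolynomial.pderiv i).toLinearMap

/-- The real vector space of harmonic homogeneous polynomials of degree `n` in `p` variables
(the zero polynomial included). -/
noncomputable def harmonicHomogeneous (p n : ℕ) : Submodule ℝ (MvPolynomial (Fin p) ℝ) :=
  MvPolynomial.homogeneousSubmodule (Fin p) ℝ n ⊓ LinearMap.ker (polyLaplacian p)

/-- `N(p, n)`: the (maximal) number of linearly independent harmonic homogeneous polynomials
of degree `n` in `p` variables. -/
noncomputable def numHarmonics (p n : ℕ) : ℕ :=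
  Module.finrank ℝ (harmonicHomogeneous p n)

/-- The unit sphere `S^{p-1}` of `ℝ^p`, as a type. -/
abbrev UnitSphere (p : ℕ) : Type :=
  Metric.sphere (0 : EuclideanSpace ℝ (Fin p)) 1

/-- The surface measure on `S^{p-1}`. -/
noncomputable def surfaceMeasure (p : ℕ) : MeasureTheory.Measure (UnitSphere p) :=
  (MeasureTheory.volume : MeasureTheory.Measure (EuclideanSpace ℝ (Fin p))).toSphere

/-- `Ω_{p-1}`: the surface area of `S^{p-1}`. -/
noncomputable def surfaceArea (p : ℕ) : ℝ :=
  (surfaceMeasure p).real Set.univ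

/-- The value of a polynomial at a point of `ℝ^p`. -/
noncomputable def evalAt {p : ℕ} (H : MvPolynomial (Fin p) ℝ) (x : EuclideanSpace ℝ (Fin p)) : ℝ :=
  MvPolynomial.eval (fun i => x i) H

/-- `Y : S^{p-1} → ℝ` is a spherical harmonic of degree `n`: the restriction to the sphere of
a harmonic homogeneous polynomial of degree `n`. -/
def IsSphericalHarmonic (p n : ℕ) (Y : UnitSphere p → ℝ) : Prop :=
  ∃ H ∈ harmonicHomogeneous p n, ∀ ξ : UnitSphere p, Y ξ = evalAt H ξ

/-- `Y₁, …, Y_N`, with `N = N(p, n)`, is an orthonormal set of spherical harmonics of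
degree `n`. -/
def IsOrthonormalHarmonics (p n : ℕ) (Y : Fin (numHarmonics p n) → UnitSphere p → ℝ) : Prop :=
  (∀ j, IsSphericalHarmonic p n (Y j)) ∧
    ∀ i j, ∫ ξ, Y i ξ * Y j ξ ∂(surfaceMeasure p) = if i = j then 1 else 0

/-- The vector `(1, 0, …, 0)` of `ℝ^p`. -/
noncomputable def northPole (p : ℕ) [NeZero p] : EuclideanSpace ℝ (Fin p) :=
  EuclideanSpace.single 0 1

/-- `L` is a harmonic homogeneous polynomial of degree `n` that takes the value `1` at
`(1, 0, …, 0)` and is invariant under all linear isometries of `ℝ^p` (orthogonal matrices)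
that fix `(1, 0, …, 0)`. -/
def IsLegendreHarmonic (p n : ℕ) [NeZero p] (L : MvPolynomial (Fin p) ℝ) : Prop :=
  L ∈ harmonicHomogeneous p n ∧
    evalAt L (northPole p) = 1 ∧
    ∀ R : EuclideanSpace ℝ (Fin p) ≃ₗᵢ[ℝ] EuclideanSpace ℝ (Fin p),
      R (northPole p) = northPole p → ∀ x, evalAt L (R x) = evalAt L x

/-- `P` is the Legendre polynomial of degree `n` in dimension `p`: on the sphere, the harmonic
`L` above is the polynomial `P` of `t = ⟪ξ, (1, 0, …, 0)⟫`. -/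
def IsLegendrePolynomial (p n : ℕ) [NeZero p] (P : Polynomial ℝ) : Prop :=
  ∃ L : MvPolynomial (Fin p) ℝ, IsLegendreHarmonic p n L ∧
    ∀ ξ : UnitSphere p,
      evalAt L ξ = P.eval (inner ℝ (ξ : EuclideanSpace ℝ (Fin p)) (northPole p))

/-!
Fix polynomials `H_j` restricting to the orthonormal system `Y_j`. Being `N(p, n)` many and linearly
independent, they form a basis of the harmonic homogeneous polynomials of degree `n`. Both the
harmonic polynomials (`rotate_mem_harmonicHomogeneous`, by the chain rule) and the surface measure
(`measurePreserving_sphereMap`) are invariant under linear isometries `R`, so `H_j ∘ R` is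
again an orthonormal basis, the change of basis is an orthogonal matrix, and the kernel
`K(x, y) = ∑ H_j(x) H_j(y)` satisfies `K(R x, R y) = K(x, y)` (`sum_evalAt_mul_evalAt_isometry`).
Since isometries act transitively on the sphere, `K(ξ, ξ)` is constant there, and integrating it
gives `Ω K(e, e) = N` (`surfaceArea_mul_sum_sq`). Hence `(Ω / N) K(e, ·)` is harmonic, equal to `1` at the
pole `e`, and invariant under the stabiliser of `e`.

It remains to know that there is exactly one such polynomial. A homogeneous polynomial fixed by the
stabiliser of `e` takes equal values at points of equal length and height, which forces it to be
`∑ a_k x₀ ^ (n - 2 k) (x₁² + … + x_{p-1}²) ^ k` (`exists_eq_zonalPoly`). The Laplacian turns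
harmonicity into a two-term recursion for the `a_k` (`polyLaplacian_zonalPoly`): solving it from
`a₀ = 1` gives existence (`exists_isLegendreHarmonic_zonalPoly`, whence also `N > 0`), and
`a₀ = L(e)` gives uniqueness (`IsLegendreHarmonic.unique`). In dimension one homogeneity alone gives uniqueness.
The general pair `(ξ, η)` reduces to `(R ξ, e)` with an isometry `R` taking `η` to `e`.
-/

section
open MvPolynomial

/-! ### Isometries acting on harmonic polynomials -/

/-- The polynomial `H ∘ R`, for a linear isometry `R` of `ℝ^p`, as an algebra homomorphism
in `H`. -/
noncomputable def rotate {p : ℕ} (R : EuclideanSpace ℝ (Fin p) ≃ₗᵢ[ℝ] EuclideanSpace ℝ (Fin p)) :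
    MvPolynomial (Fin p) ℝ →ₐ[ℝ] MvPolynomial (Fin p) ℝ :=
  MvPolynomial.aeval fun j => ∑ i, C (R (EuclideanSpace.single i 1) j) * X i

lemma isometry_apply_coord {p : ℕ}
    (R : EuclideanSpace ℝ (Fin p) ≃ₗᵢ[ℝ] EuclideanSpace ℝ (Fin p)) (x) (j : Fin p) :
    R x j = ∑ i, R (EuclideanSpace.single i 1) j * x i := by
  conv_lhs => rw [← (EuclideanSpace.basisFun (Fin p) ℝ).sum_repr x]
  simp [mul_comm]

lemma evalAt_rotate {p : ℕ}
    (R : EuclideanSpace ℝ (Fin p) ≃ₗᵢ[ℝ] EuclideanSpace ℝ (Fin p)) (H : MvPolynomial (Fin p) ℝ)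
    (x) :
    evalAt (rotate R H) x = evalAt H (R x) := by
  induction H using MvPolynomial.induction_on with
  | C a => simp [rotate, evalAt]
  | add f g hf hg => simp_all [evalAt]
  | mul_X f j hf =>
    simp only [evalAt, map_mul] at hf ⊢
    rw [hf, eval_X, isometry_apply_coord R x j]
    simp [rotate]

/-- The chain rule for composition with a linear isometry. -/
lemma pderiv_rotate {p : ℕ}
    (R : EuclideanSpace ℝ (Fin p) ≃ₗᵢ[ℝ] EuclideanSpace ℝ (Fin p)) (H : MvPolynomial (Fin p) ℝ)
    (i : Fin p) :
    pderiv i (rotate R H) =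
      ∑ j, C (R (EuclideanSpace.single i 1) j) * rotate R (pderiv j H) := by
  induction H using MvPolynomial.induction_on with
  | C a => simp [rotate]
  | add f g hf hg => simp [hf, hg, mul_add, Finset.sum_add_distrib]
  | mul_X f j hf =>
    have hX : pderiv i (rotate R (X j)) = C (R (EuclideanSpace.single i 1) j) := by
      simp [rotate, pderiv_X, Pi.single_apply]
    have hs : ∀ k, C (R (EuclideanSpace.single i 1) k) * rotate R (pderiv k (f * X j)) =
        C (R (EuclideanSpace.single i 1) k) * rotate R (pderiv k f) * rotate R (X j) +
          if k = j then rotate R f * C (R (EuclideanSpace.single i 1) j) else 0 := by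
      intro k
      rw [pderiv_mul, map_add, map_mul, map_mul]
      by_cases hk : k = j
      · subst hk
        rw [pderiv_X_self, map_one, if_pos rfl]
        ring
      · rw [pderiv_X_of_ne (Ne.symm hk), map_zero, if_neg hk]
        ring
    rw [map_mul, pderiv_mul, hf, hX, Finset.sum_congr rfl fun k _ => hs k,
      Finset.sum_add_distrib, Finset.sum_mul]
    simp

lemma sum_isometry_coord_mul {p : ℕ}
    (R : EuclideanSpace ℝ (Fin p) ≃ₗᵢ[ℝ] EuclideanSpace ℝ (Fin p)) (j k : Fin p) :
    ∑ i, R (EuclideanSpace.single i 1) j * R (EuclideanSpace.single i 1) k =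
      if j = k then 1 else 0 := by
  let A : Matrix (Fin p) (Fin p) ℝ :=
    Matrix.of fun i j => R (EuclideanSpace.single i 1) j
  have h : A * A.transpose = 1 := by
    ext i k
    have h := R.inner_map_map (EuclideanSpace.single k (1 : ℝ)) (EuclideanSpace.single i (1 : ℝ))
    rw [PiLp.inner_apply, EuclideanSpace.inner_single_left] at h
    simpa [Matrix.mul_apply, Matrix.one_apply, A, Pi.single_apply, eq_comm] using h
  have h' : A.transpose * A = 1 := mul_eq_one_comm.mp h
  simpa [Matrix.mul_apply, A, Matrix.one_apply] using congrFun (congrFun h' j) k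

lemma polyLaplacian_apply (p : ℕ) (H : MvPolynomial (Fin p) ℝ) :
    polyLaplacian p H = ∑ i, pderiv i (pderiv i H) := by
  simp [polyLaplacian]

lemma polyLaplacian_rotate {p : ℕ}
    (R : EuclideanSpace ℝ (Fin p) ≃ₗᵢ[ℝ] EuclideanSpace ℝ (Fin p)) (H : MvPolynomial (Fin p) ℝ) :
    polyLaplacian p (rotate R H) = rotate R (polyLaplacian p H) := by
  have h : ∀ j k : Fin p, ∑ i, C (R (EuclideanSpace.single i 1) j) *
      (C (R (EuclideanSpace.single i 1) k) * rotate R (pderiv k (pderiv j H))) =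
      if j = k then rotate R (pderiv k (pderiv j H)) else 0 := by
    intro j k
    simp only [← mul_assoc, ← C_mul, ← Finset.sum_mul, ← map_sum, sum_isometry_coord_mul]
    split <;> simp
  simp only [polyLaplacian_apply, pderiv_rotate, map_sum, pderiv_C_mul, Finset.mul_sum]
  rw [Finset.sum_comm]
  refine Finset.sum_congr rfl fun j _ => ?_
  rw [Finset.sum_comm]
  simp [h]

lemma mem_harmonicHomogeneous {p n : ℕ} {H : MvPolynomial (Fin p) ℝ} :
    H ∈ harmonicHomogeneous p n ↔ H.IsHomogeneous n ∧ polyLaplacian p H = 0 :=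
  Iff.rfl

lemma rotate_mem_harmonicHomogeneous {p n : ℕ}
    (R : EuclideanSpace ℝ (Fin p) ≃ₗᵢ[ℝ] EuclideanSpace ℝ (Fin p)) {H : MvPolynomial (Fin p) ℝ}
    (hH : H ∈ harmonicHomogeneous p n) : rotate R H ∈ harmonicHomogeneous p n := by
  rw [mem_harmonicHomogeneous] at hH ⊢
  refine ⟨?_, by rw [polyLaplacian_rotate, hH.2, map_zero]⟩
  simpa [rotate] using hH.1.aeval (n := 1)
    (fun j => ∑ i, C (R (EuclideanSpace.single i 1) j) * X i) fun j =>
      IsHomogeneous.sum _ _ _ fun i _ => isHomogeneous_C_mul_X _ i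

/-! ### Isometries acting on the sphere -/

/-- The action of a linear isometry on the unit sphere. -/
noncomputable def sphereMap {p : ℕ}
    (R : EuclideanSpace ℝ (Fin p) ≃ₗᵢ[ℝ] EuclideanSpace ℝ (Fin p)) (ξ : UnitSphere p) :
    UnitSphere p :=
  ⟨R ξ, by simp⟩

open scoped Pointwise in
lemma measurePreserving_sphereMap {p : ℕ}
    (R : EuclideanSpace ℝ (Fin p) ≃ₗᵢ[ℝ] EuclideanSpace ℝ (Fin p)) :
    MeasureTheory.MeasurePreserving (sphereMap R) (surfaceMeasure p) (surfaceMeasure p) := by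
  have hm : Measurable (sphereMap R) :=
    ((R.continuous.comp continuous_subtype_val).subtype_mk _).measurable
  refine ⟨hm, ?_⟩
  ext s hs
  rw [MeasureTheory.Measure.map_apply hm hs, surfaceMeasure,
    MeasureTheory.Measure.toSphere_apply' _ (hm hs), MeasureTheory.Measure.toSphere_apply' _ hs]
  congr 1
  have hR := R.measurePreserving.measure_preimage_equiv
    (f := R.toMeasurableEquiv) (Set.Ioo (0 : ℝ) 1 • ((↑) '' s))
  rw [← hR]
  congr 1
  ext x
  simp only [Set.mem_smul, Set.mem_image, Set.mem_preimage]
  constructor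
  · rintro ⟨r, hr, _, ⟨ξ, hξ, rfl⟩, rfl⟩
    exact ⟨r, hr, _, ⟨_, hξ, rfl⟩, by simp [sphereMap]⟩
  · rintro ⟨r, hr, _, ⟨ξ, hξ, rfl⟩, hx⟩
    refine ⟨r, hr, _, ⟨sphereMap R.symm ξ, ?_, rfl⟩, ?_⟩
    · simpa [sphereMap] using hξ
    · apply R.injective
      simpa [sphereMap] using hx

/-! ### Evaluation of homogeneous polynomials -/

lemma evalAt_smul {p n : ℕ} {H : MvPolynomial (Fin p) ℝ} (hH : H.IsHomogeneous n) (c : ℝ)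
    (x : EuclideanSpace ℝ (Fin p)) : evalAt H (c • x) = c ^ n * evalAt H x := by
  simp only [evalAt, eval_eq, Finset.mul_sum]
  refine Finset.sum_congr rfl fun d hd => ?_
  have h : ∑ i, d i = n := by
    have := hH (mem_support_iff.mp hd)
    simpa [Finsupp.weight_apply, Finsupp.sum_fintype] using this
  simp only [PiLp.smul_apply, smul_eq_mul, mul_pow]
  have h2 : ∏ i ∈ d.support, c ^ d i = c ^ n := by
    rw [← h, ← Finset.prod_pow_eq_pow_sum]
    refine Finset.prod_subset (Finset.subset_univ _) fun i _ hi => ?_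
    rw [Finsupp.notMem_support_iff.mp hi, pow_zero]
  rw [Finset.prod_mul_distrib, h2]
  ring

lemma evalAt_ext {p : ℕ} {H K : MvPolynomial (Fin p) ℝ} (h : ∀ x, evalAt H x = evalAt K x) :
    H = K :=
  MvPolynomial.funext fun x => h (WithLp.toLp 2 x)

/-! ### The Laplacian of zonal polynomials -/

/-- The polynomial `x₁² + … + x_{p-1}²`, the squared distance to the axis through
the vector `(1, 0, …, 0)`. -/
noncomputable def axialSq (p : ℕ) [NeZero p] : MvPolynomial (Fin p) ℝ :=
  ∑ i ∈ Finset.univ.erase (0 : Fin p), X i ^ 2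

/-- The polynomial `∑ k ≤ n / 2, a k · x₀ ^ (n - 2 k) · (x₁² + … + x_{p-1}²) ^ k`, homogeneous of
degree `n`. -/
noncomputable def zonalPoly (p n : ℕ) [NeZero p] (a : ℕ → ℝ) : MvPolynomial (Fin p) ℝ :=
  ∑ k ∈ Finset.range (n / 2 + 1), C (a k) * (X 0 ^ (n - 2 * k) * axialSq p ^ k)

section
variable {p : ℕ} [NeZero p]

lemma pderiv_axialSq_zero : pderiv 0 (axialSq p) = 0 := by
  rw [axialSq, map_sum]
  refine Finset.sum_eq_zero fun i hi => ?_
  rw [pderiv_pow, pderiv_X_of_ne (Finset.ne_of_mem_erase hi), mul_zero]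

lemma pderiv_axialSq {i : Fin p} (hi : i ≠ 0) : pderiv i (axialSq p) = 2 * X i := by
  rw [axialSq, map_sum, Finset.sum_eq_single i]
  · simp
  · intro j _ hj
    rw [pderiv_pow, pderiv_X_of_ne hj, mul_zero]
  · simp [hi]

lemma polyLaplacian_X_pow_mul_axialSq_pow (m k : ℕ) :
    polyLaplacian p (X 0 ^ m * axialSq p ^ k) =
      C ((m : ℝ) * (m - 1)) * (X 0 ^ (m - 2) * axialSq p ^ k) +
        C (2 * k * (2 * k + p - 3) : ℝ) * (X 0 ^ m * axialSq p ^ (k - 1)) := by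
  have h0 : pderiv 0 (pderiv 0 (X 0 ^ m * axialSq p ^ k)) =
      C ((m : ℝ) * (m - 1)) * (X 0 ^ (m - 2) * axialSq p ^ k) := by
    have h : ∀ l : ℕ, pderiv 0 (X 0 ^ l * axialSq p ^ k) =
        C (l : ℝ) * (X 0 ^ (l - 1) * axialSq p ^ k) := by
      intro l
      simp only [pderiv_mul, pderiv_pow, pderiv_axialSq_zero, pderiv_X_self, map_natCast]
      ring
    rw [h, pderiv_C_mul, h, ← mul_assoc, ← C_mul, Nat.sub_sub]
    rcases m with _ | m <;> simp
  have hi : ∀ i ∈ Finset.univ.erase (0 : Fin p), pderiv i (pderiv i (X 0 ^ m * axialSq p ^ k)) =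
      C (4 * k * (k - 1) : ℝ) * (X 0 ^ m * axialSq p ^ (k - 2)) * X i ^ 2 +
        C (2 * k : ℝ) * (X 0 ^ m * axialSq p ^ (k - 1)) := by
    intro i hi
    have hi := Finset.ne_of_mem_erase hi
    have h : ∀ l : ℕ, pderiv i (X 0 ^ m * axialSq p ^ l) =
        C (2 * l : ℝ) * (X 0 ^ m * axialSq p ^ (l - 1)) * X i := by
      intro l
      simp only [pderiv_mul, pderiv_pow, pderiv_axialSq hi, pderiv_X_of_ne hi.symm, C_mul,
        map_natCast, map_ofNat]
      ring
    rw [h, pderiv_mul, pderiv_C_mul, h, pderiv_X_self, Nat.sub_sub]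
    rcases k with _ | k
    · simp
    · simp only [Nat.add_sub_cancel, Nat.cast_add, Nat.cast_one, C_mul, map_natCast, map_ofNat,
        add_sub_cancel_right, C_add, map_one]
      ring
  have hcard : ((Finset.univ.erase (0 : Fin p)).card : MvPolynomial (Fin p) ℝ) =
      C ((p : ℝ) - 1) := by
    rw [Finset.card_erase_of_mem (Finset.mem_univ _), Finset.card_univ, Fintype.card_fin,
      Nat.cast_pred (NeZero.pos p)]
    simp
  rw [polyLaplacian_apply, ← Finset.add_sum_erase _ _ (Finset.mem_univ (0 : Fin p)), h0,
    Finset.sum_congr rfl hi, Finset.sum_add_distrib, ← Finset.mul_sum, ← axialSq,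
    Finset.sum_const, nsmul_eq_mul, hcard]
  congr 1
  rcases k with _ | _ | k
  · simp
  · simp only [zero_add, Nat.cast_one, sub_self, mul_zero, C_0, zero_mul, Nat.sub_self, mul_one]
    rw [← mul_assoc, ← C_mul]
    congr 2
    ring
  · simp only [show k + 1 + 1 - 1 = k + 1 from rfl, show k + 1 + 1 - 2 = k from rfl,
      Nat.cast_add, Nat.cast_one, C_mul, map_natCast, map_ofNat, map_add, map_sub, map_one]
    ring

/-- The coefficient recursion: for `2 ≤ p`, `zonalPoly p n a` is harmonic if and only if
the coefficient of each summand on the right-hand side vanishes. -/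
lemma polyLaplacian_zonalPoly (n : ℕ) (a : ℕ → ℝ) :
    polyLaplacian p (zonalPoly p n a) = ∑ k ∈ Finset.range (n / 2),
      C (a k * (((n : ℝ) - 2 * k) * (n - 2 * k - 1)) +
          a (k + 1) * (2 * (k + 1) * (2 * k + p - 1))) *
        (X 0 ^ (n - 2 * k - 2) * axialSq p ^ k) := by
  have hsmul : ∀ (c : ℝ) (f : MvPolynomial (Fin p) ℝ),
      polyLaplacian p (C c * f) = C c * polyLaplacian p f := fun c f => by
    rw [← smul_eq_C_mul, map_smul, smul_eq_C_mul]
  simp only [zonalPoly, map_sum, hsmul, polyLaplacian_X_pow_mul_axialSq_pow, mul_add,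
    Finset.sum_add_distrib]
  rw [Finset.sum_range_succ, Finset.sum_range_succ' (fun k => C (a k) * (C (2 * (k : ℝ) *
    (2 * k + p - 3)) * (X 0 ^ (n - 2 * k) * axialSq p ^ (k - 1))))]
  -- The top exponent of `x₀` is `0` or `1`, so its second derivative vanishes.
  have htop : ((n - 2 * (n / 2) : ℕ) : ℝ) * ((n - 2 * (n / 2) : ℕ) - 1) = 0 := by
    have : n - 2 * (n / 2) = 0 ∨ n - 2 * (n / 2) = 1 := by omega
    rcases this with h | h <;> simp [h]
  rw [htop]
  simp only [map_zero, zero_mul, mul_zero, add_zero, CharP.cast_eq_zero]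
  rw [← Finset.sum_add_distrib]
  refine Finset.sum_congr rfl fun k hk => ?_
  have hk : 2 * k ≤ n := by have := Finset.mem_range.mp hk; omega
  have hm : ((n - 2 * k : ℕ) : ℝ) = n - 2 * k := by rw [Nat.cast_sub hk]; push_cast; rfl
  have hb : 2 * ((k + 1 : ℕ) : ℝ) * (2 * (k + 1 : ℕ) + p - 3) = 2 * (k + 1) * (2 * k + p - 1) := by
    push_cast; ring
  rw [show n - 2 * (k + 1) = n - 2 * k - 2 by omega, Nat.add_sub_cancel, hm, hb, C_add,
    C_mul (a := a k), C_mul (a := a (k + 1))]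
  ring_nf

lemma isHomogeneous_axialSq : (axialSq p).IsHomogeneous 2 :=
  IsHomogeneous.sum _ _ _ fun i _ => isHomogeneous_X_pow i 2

lemma isHomogeneous_zonalPoly (n : ℕ) (a : ℕ → ℝ) : (zonalPoly p n a).IsHomogeneous n := by
  refine IsHomogeneous.sum _ _ _ fun k hk => IsHomogeneous.C_mul ?_ _
  have h := (isHomogeneous_X_pow (R := ℝ) (0 : Fin p) (n - 2 * k)).mul
    ((isHomogeneous_axialSq (p := p)).pow k)
  have hk : 2 * k ≤ n := by have := Finset.mem_range.mp hk; omega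
  rwa [Nat.sub_add_cancel hk] at h

lemma evalAt_axialSq (x : EuclideanSpace ℝ (Fin p)) :
    evalAt (axialSq p) x = ‖x‖ ^ 2 - x 0 ^ 2 := by
  rw [EuclideanSpace.real_norm_sq_eq, ← Finset.add_sum_erase _ _ (Finset.mem_univ (0 : Fin p))]
  simp [evalAt, axialSq]

lemma evalAt_zonalPoly (n : ℕ) (a : ℕ → ℝ) (x : EuclideanSpace ℝ (Fin p)) :
    evalAt (zonalPoly p n a) x =
      ∑ k ∈ Finset.range (n / 2 + 1), a k * (x 0 ^ (n - 2 * k) * (‖x‖ ^ 2 - x 0 ^ 2) ^ k) := by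
  simp only [← evalAt_axialSq]
  simp [zonalPoly, evalAt]

lemma inner_northPole (x : EuclideanSpace ℝ (Fin p)) : inner ℝ x (northPole p) = x 0 := by
  simp [northPole, EuclideanSpace.inner_single_right]

lemma norm_northPole : ‖northPole p‖ = 1 := by simp [northPole]

lemma isometry_apply_zero {R : EuclideanSpace ℝ (Fin p) ≃ₗᵢ[ℝ] EuclideanSpace ℝ (Fin p)}
    (hR : R (northPole p) = northPole p) (x) : R x 0 = x 0 := by
  rw [← inner_northPole, ← inner_northPole x]
  conv_lhs => rw [← hR]
  exact R.inner_map_map _ _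

/-! ### Existence and uniqueness of the Legendre harmonic -/

lemma exists_isLegendreHarmonic_zonalPoly (n : ℕ) (hpn : 2 ≤ p ∨ n ≤ 1) :
    ∃ a, IsLegendreHarmonic p n (zonalPoly p n a) := by
  -- The solution of the recursion in `polyLaplacian_zonalPoly` with `a 0 = 1`.
  let a : ℕ → ℝ := fun k => Nat.rec 1 (fun k b =>
    -(b * (((n : ℝ) - 2 * k) * (n - 2 * k - 1))) / (2 * (k + 1) * (2 * k + p - 1))) k
  refine ⟨a, mem_harmonicHomogeneous.mpr ⟨isHomogeneous_zonalPoly n a, ?_⟩, ?_, ?_⟩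
  · rw [polyLaplacian_zonalPoly]
    refine Finset.sum_eq_zero fun k hk => ?_
    -- The denominator could vanish only for `p = 1`, and then the sum is empty.
    have hp : 2 ≤ p := hpn.resolve_right fun h => by
      have := Finset.mem_range.mp hk
      omega
    have hp' : (2 : ℝ) ≤ p := by exact_mod_cast hp
    have hne : (2 * (k + 1) * (2 * k + p - 1) : ℝ) ≠ 0 := by
      have : (0 : ℝ) < 2 * k + p - 1 := by
        have : (0 : ℝ) ≤ k := k.cast_nonneg
        linarith
      positivity
    have ha : a (k + 1) = -(a k * (((n : ℝ) - 2 * k) * (n - 2 * k - 1))) /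
      (2 * (k + 1) * (2 * k + p - 1)) := rfl
    rw [ha, div_mul_cancel₀ _ hne, add_neg_cancel, C_0, zero_mul]
  · rw [evalAt_zonalPoly, norm_northPole, Finset.sum_range_succ']
    simp [northPole, a]
  · intro R hR x
    rw [evalAt_zonalPoly, evalAt_zonalPoly, isometry_apply_zero hR, R.norm_map]

/-- Two vectors of equal length at the same height are exchanged by a reflection that fixes the
pole. -/
lemma evalAt_eq_of_zonal {D : MvPolynomial (Fin p) ℝ}
    (hD : ∀ R : EuclideanSpace ℝ (Fin p) ≃ₗᵢ[ℝ] EuclideanSpace ℝ (Fin p),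
      R (northPole p) = northPole p → ∀ x, evalAt D (R x) = evalAt D x)
    {x y : EuclideanSpace ℝ (Fin p)} (h0 : x 0 = y 0) (hn : ‖x‖ = ‖y‖) :
    evalAt D x = evalAt D y := by
  rw [← hD (Submodule.reflection (ℝ ∙ (x - y))ᗮ) ?_ x, Submodule.reflection_sub hn]
  rw [Submodule.reflection_mem_subspace_eq_self]
  rw [Submodule.mem_orthogonal_singleton_iff_inner_right, inner_northPole]
  simp [h0]

/-- A homogeneous polynomial that is invariant under the stabiliser of the pole is a
combination of the monomials `x₀ ^ (n - 2 k) · (x₁² + … + x_{p-1}²) ^ k`: on the plane spanned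
by the pole and an orthogonal unit vector it is even in the second coordinate. -/
lemma exists_eq_zonalPoly {n : ℕ} (hp : 2 ≤ p) {D : MvPolynomial (Fin p) ℝ}
    (hhom : D.IsHomogeneous n)
    (hD : ∀ R : EuclideanSpace ℝ (Fin p) ≃ₗᵢ[ℝ] EuclideanSpace ℝ (Fin p),
      R (northPole p) = northPole p → ∀ x, evalAt D (R x) = evalAt D x) :
    ∃ a, D = zonalPoly p n a := by
  obtain ⟨j, hj⟩ : ∃ j : Fin p, j ≠ 0 := by
    have : Nontrivial (Fin p) := Fin.nontrivial_iff_two_le.mpr hp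
    exact exists_ne 0
  let w : ℝ → EuclideanSpace ℝ (Fin p) := fun t =>
    northPole p + EuclideanSpace.single j t
  have hw0 : ∀ t, w t 0 = 1 := fun t => by simp [w, northPole, hj.symm]
  have hwn : ∀ t, ‖w t‖ ^ 2 = 1 + t ^ 2 := fun t => by
    have : inner ℝ (northPole p) (EuclideanSpace.single j t) = 0 := by
      rw [real_inner_comm, inner_northPole]; simp [hj.symm]
    rw [pow_two, norm_add_sq_eq_norm_sq_add_norm_sq_real this, norm_northPole]
    simp [pow_two]
  -- The restriction of `D` to the line `t ↦ e + t e_j`, as a polynomial in `t`.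
  let G : Polynomial ℝ := aeval (fun i => if i = 0 then 1 else if i = j then Polynomial.X else 0) D
  have hG : ∀ t, G.eval t = evalAt D (w t) := by
    intro t
    have : (Polynomial.evalRingHom t).comp (aeval (R := ℝ) (fun i : Fin p =>
        if i = 0 then (1 : Polynomial ℝ) else if i = j then Polynomial.X else 0)).toRingHom =
        eval fun i => w t i := by
      ext i
      · simp
      · by_cases hi : i = 0
        · subst hi; simp [hw0]
        · by_cases hij : i = j
          · subst hij; simp [hi, w, northPole]
          · simp [hi, hij, w, northPole]
    exact congrArg (fun f => f D) this
  have hGdeg : G.natDegree ≤ n := by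
    have := MvPolynomial.aeval_natDegree_le (n := 1) D hhom.totalDegree_le
      (fun i : Fin p => if i = 0 then (1 : Polynomial ℝ) else if i = j then Polynomial.X else 0)
      fun i => by
        split_ifs <;> simp
    simpa using this
  have hGeven : G.comp (Polynomial.C (-1) * Polynomial.X) = G := by
    refine Polynomial.funext fun t => ?_
    rw [Polynomial.eval_comp, hG, hG]
    refine evalAt_eq_of_zonal hD (by rw [hw0, hw0]) ?_
    rw [← sq_eq_sq₀ (norm_nonneg _) (norm_nonneg _), hwn, hwn]
    simp
  -- `G` is even, so it is a polynomial in `t ^ 2`.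
  let Q := Polynomial.contract 2 G
  have hQ : Polynomial.expand ℝ 2 Q = G := by
    ext k
    rw [Polynomial.coeff_expand two_pos]
    split_ifs with hk
    · rw [Polynomial.coeff_contract two_ne_zero, Nat.div_mul_cancel hk]
    · have := congrArg (fun f => Polynomial.coeff f k) hGeven
      simp only [Polynomial.comp_C_mul_X_coeff,
        Odd.neg_one_pow (Nat.not_even_iff_odd.mp fun h => hk h.two_dvd)] at this
      linarith
  have hQdeg : Q.natDegree < n / 2 + 1 := by
    have := Polynomial.natDegree_expand 2 Q
    rw [hQ] at this
    omega
  -- Homogeneity recovers `D` from `G` only where `x₀ ≠ 0`; the factor `x₀` removes the exception.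
  refine ⟨Q.coeff, mul_left_cancel₀ (X_ne_zero (0 : Fin p)) (evalAt_ext fun x => ?_)⟩
  have hmul : ∀ F : MvPolynomial (Fin p) ℝ, evalAt (X 0 * F) x = x 0 * evalAt F x := fun F => by
    simp [evalAt]
  rw [hmul, hmul]
  by_cases hx : x 0 = 0
  · simp [hx]
  congr 1
  set s := x 0 with hs
  have hρ : 0 ≤ ‖x‖ ^ 2 - s ^ 2 := by
    rw [← evalAt_axialSq]
    simp only [evalAt, axialSq, map_sum, map_pow, eval_X]
    positivity
  have hxw : evalAt D (s⁻¹ • x) = evalAt D (w (√(‖x‖ ^ 2 - s ^ 2) / s)) := by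
    refine evalAt_eq_of_zonal hD (by simp [hw0, ← hs, hx]) ?_
    rw [← sq_eq_sq₀ (norm_nonneg _) (norm_nonneg _), hwn, norm_smul, div_pow, Real.sq_sqrt hρ,
      mul_pow, Real.norm_eq_abs, sq_abs]
    field_simp
    ring
  have hxs : x = s • (s⁻¹ • x) := by rw [smul_smul, mul_inv_cancel₀ hx, one_smul]
  rw [evalAt_zonalPoly, ← hs]
  conv_lhs => rw [hxs]
  rw [evalAt_smul hhom, hxw, ← hG, ← hQ, Polynomial.expand_eval, div_pow, Real.sq_sqrt hρ,
    Polynomial.eval_eq_sum_range' hQdeg, Finset.mul_sum]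
  refine Finset.sum_congr rfl fun k hk => ?_
  have hk : 2 * k ≤ n := by have := Finset.mem_range.mp hk; omega
  rw [pow_sub₀ _ hx hk, div_pow, ← pow_mul]
  field_simp

/-- A harmonic zonal polynomial vanishing at the pole is zero. -/
lemma eq_zero_of_zonal_of_evalAt_northPole {n : ℕ} {D : MvPolynomial (Fin p) ℝ}
    (hmem : D ∈ harmonicHomogeneous p n)
    (hD : ∀ R : EuclideanSpace ℝ (Fin p) ≃ₗᵢ[ℝ] EuclideanSpace ℝ (Fin p),
      R (northPole p) = northPole p → ∀ x, evalAt D (R x) = evalAt D x)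
    (h0 : evalAt D (northPole p) = 0) : D = 0 := by
  rw [mem_harmonicHomogeneous] at hmem
  rcases Nat.lt_or_ge p 2 with hp | hp
  · -- In dimension one every vector is a multiple of the pole.
    have hp1 : p = 1 := by have := NeZero.pos p; omega
    subst hp1
    refine evalAt_ext fun x => ?_
    have hx : x = x 0 • northPole 1 := by
      ext i
      rw [Subsingleton.elim i 0]
      simp [northPole]
    rw [hx, evalAt_smul hmem.1, h0]
    simp [evalAt]
  obtain ⟨a, rfl⟩ := exists_eq_zonalPoly hp hmem.1 hD
  have ha0 : a 0 = 0 := by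
    rw [evalAt_zonalPoly, norm_northPole, Finset.sum_range_succ'] at h0
    simpa [northPole] using h0
  have hlap := hmem.2
  rw [polyLaplacian_zonalPoly] at hlap
  obtain ⟨j, hj⟩ : ∃ j : Fin p, j ≠ 0 := by
    have : Nontrivial (Fin p) := Fin.nontrivial_iff_two_le.mpr hp
    exact exists_ne 0
  let c : ℕ → ℝ := fun k => a k * (((n : ℝ) - 2 * k) * (n - 2 * k - 1)) +
          a (k + 1) * (2 * (k + 1) * (2 * k + p - 1))
  -- Along `(1, √s)` the Laplacian is a polynomial in `s ≥ 0`, so its coefficients vanish.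
  have hc : ∑ k ∈ Finset.range (n / 2), Polynomial.monomial k (c k) = 0 := by
    refine Polynomial.eq_zero_of_infinite_isRoot _ (Set.Infinite.mono ?_ (Set.Ici_infinite (0 : ℝ)))
    intro s hs
    let x : EuclideanSpace ℝ (Fin p) := northPole p + EuclideanSpace.single j √s
    have hx0 : x 0 = 1 := by simp [x, northPole, hj.symm]
    have hxn : ‖x‖ ^ 2 - x 0 ^ 2 = s := by
      have : inner ℝ (northPole p) (EuclideanSpace.single j √s) = 0 := by
        rw [real_inner_comm, inner_northPole]; simp [hj.symm]
      rw [hx0, pow_two, norm_add_sq_eq_norm_sq_add_norm_sq_real this, norm_northPole]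
      simp [← pow_two, Real.sq_sqrt (Set.mem_Ici.mp hs)]
    have h := congrArg (fun F => evalAt F x) hlap
    have hax := evalAt_axialSq x
    rw [hxn] at hax
    simp only [evalAt] at hax
    simp only [evalAt, map_sum, map_mul, map_pow, eval_C, eval_X, hax, hx0, one_pow, one_mul,
      map_zero] at h
    simpa [Polynomial.IsRoot.def, Polynomial.eval_finsetSum, c, add_mul] using h
  have hck : ∀ k < n / 2, c k = 0 := by
    intro k hk
    have := congrArg (fun F => Polynomial.coeff F k) hc
    simpa [Polynomial.finsetSum_coeff, Polynomial.coeff_monomial, hk] using this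
  have ha : ∀ k, k < n / 2 + 1 → a k = 0 := by
    intro k
    induction k with
    | zero => exact fun _ => ha0
    | succ k ih =>
      intro hk
      have h := hck k (by omega)
      have hp' : (2 : ℝ) ≤ p := by exact_mod_cast hp
      have hne : (2 * (k + 1) * (2 * k + p - 1) : ℝ) ≠ 0 := by
        have : (0 : ℝ) < 2 * k + p - 1 := by
          have : (0 : ℝ) ≤ k := k.cast_nonneg
          linarith
        positivity
      simpa only [c, ih (by omega), zero_mul, zero_add, mul_eq_zero, hne, or_false] using h
  refine Finset.sum_eq_zero fun k hk => ?_
  rw [ha k (Finset.mem_range.mp hk), C_0, zero_mul]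

lemma IsLegendreHarmonic.unique {n : ℕ} {L L' : MvPolynomial (Fin p) ℝ}
    (h : IsLegendreHarmonic p n L) (h' : IsLegendreHarmonic p n L') : L = L' := by
  have hsub : ∀ x, evalAt (L - L') x = evalAt L x - evalAt L' x := fun x => by simp [evalAt]
  refine sub_eq_zero.mp (eq_zero_of_zonal_of_evalAt_northPole (Submodule.sub_mem _ h.1 h'.1) ?_ ?_)
  · intro R hR x
    rw [hsub, hsub, h.2.2 R hR, h'.2.2 R hR]
  · rw [hsub, h.2.1, h'.2.1, sub_self]

end

/-! ### The reproducing kernel -/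

instance (p : ℕ) : MeasureTheory.IsFiniteMeasure (surfaceMeasure p) :=
  inferInstanceAs (MeasureTheory.IsFiniteMeasure
    (MeasureTheory.volume : MeasureTheory.Measure (EuclideanSpace ℝ (Fin p))).toSphere)

lemma integrable_evalAt {p : ℕ} (F : MvPolynomial (Fin p) ℝ) :
    MeasureTheory.Integrable (fun ξ : UnitSphere p => evalAt F ξ) (surfaceMeasure p) := by
  have hc : Continuous fun ξ : UnitSphere p => evalAt F ξ :=
    (MvPolynomial.continuous_eval F).comp
      ((PiLp.continuous_ofLp 2 _).comp continuous_subtype_val)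
  exact hc.integrable_of_hasCompactSupport (HasCompactSupport.of_compactSpace _)

/-- The bilinear form `(F, G) ↦ ∫ F G` over the unit sphere, on polynomials. -/
noncomputable def sphereForm (p : ℕ) :
    MvPolynomial (Fin p) ℝ →ₗ[ℝ] MvPolynomial (Fin p) ℝ →ₗ[ℝ] ℝ :=
  (LinearMap.mul ℝ (MvPolynomial (Fin p) ℝ)).compr₂
    { toFun := fun F => ∫ ξ : UnitSphere p, evalAt F ξ ∂(surfaceMeasure p)
      map_add' := fun F G => by
        rw [← MeasureTheory.integral_add (integrable_evalAt F) (integrable_evalAt G)]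
        simp [evalAt]
      map_smul' := fun c F => by
        rw [RingHom.id_apply, smul_eq_mul, ← MeasureTheory.integral_const_mul]
        simp [evalAt] }

lemma sphereForm_apply {p : ℕ} (F G : MvPolynomial (Fin p) ℝ) :
    sphereForm p F G = ∫ ξ : UnitSphere p, evalAt F ξ * evalAt G ξ ∂(surfaceMeasure p) := by
  simp [sphereForm, evalAt]

lemma sphereForm_rotate {p : ℕ}
    (R : EuclideanSpace ℝ (Fin p) ≃ₗᵢ[ℝ] EuclideanSpace ℝ (Fin p)) (F G : MvPolynomial (Fin p) ℝ) :
    sphereForm p (rotate R F) (rotate R G) = sphereForm p F G := by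
  have hint := integrable_evalAt (F * G)
  have hR := measurePreserving_sphereMap R
  simp only [sphereForm_apply, evalAt_rotate]
  simp only [evalAt, map_mul] at hint ⊢
  rw [← hR.map_eq] at hint
  have := MeasureTheory.integral_map hR.measurable.aemeasurable hint.aestronglyMeasurable
  rw [hR.map_eq] at this
  exact this.symm

instance (p n : ℕ) : Module.Finite ℝ (harmonicHomogeneous p n) := by
  have : Module.Finite ℝ (homogeneousSubmodule (Fin p) ℝ n) :=
    Module.Finite.iff_fg.mpr (homogeneousSubmodule_fg _ _ n)
  exact Submodule.finiteDimensional_of_le (inf_le_left : harmonicHomogeneous p n ≤ _)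

section
variable {p n : ℕ} {H : Fin (numHarmonics p n) → MvPolynomial (Fin p) ℝ}

lemma sphereForm_sum_smul
    (ho : ∀ i j, sphereForm p (H i) (H j) = if i = j then 1 else 0)
    (c d : Fin (numHarmonics p n) → ℝ) :
    sphereForm p (∑ j, c j • H j) (∑ j, d j • H j) = ∑ j, c j * d j := by
  simp [ho, mul_comm]

lemma exists_eq_sum_smul (hmem : ∀ j, H j ∈ harmonicHomogeneous p n)
    (ho : ∀ i j, sphereForm p (H i) (H j) = if i = j then 1 else 0)
    {F : MvPolynomial (Fin p) ℝ} (hF : F ∈ harmonicHomogeneous p n) :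
    ∃ c : Fin (numHarmonics p n) → ℝ, F = ∑ j, c j • H j := by
  have hli : LinearIndependent ℝ fun j => (⟨H j, hmem j⟩ : harmonicHomogeneous p n) := by
    rw [Fintype.linearIndependent_iff]
    intro g hg i
    have hg' : ∑ j, g j • H j = 0 := by simpa using congrArg Subtype.val hg
    have h := sphereForm_sum_smul ho g (Pi.single i 1)
    rw [hg', map_zero, LinearMap.zero_apply] at h
    simpa [Pi.single_apply] using h.symm
  have hspan := hli.span_eq_top_of_card_eq_finrank' (Fintype.card_fin _)
  have hF' : (⟨F, hF⟩ : harmonicHomogeneous p n) ∈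
      Submodule.span ℝ (Set.range fun j => (⟨H j, hmem j⟩ : harmonicHomogeneous p n)) := by
    rw [hspan]; trivial
  obtain ⟨c, hc⟩ := (Submodule.mem_span_range_iff_exists_fun ℝ).mp hF'
  exact ⟨c, by simpa using (congrArg Subtype.val hc).symm⟩

/-- The reproducing kernel `∑ H_j(x) H_j(y)` is invariant under isometries: the change of basis from
`H_j` to `H_j ∘ R` is an orthogonal matrix. -/
lemma sum_evalAt_mul_evalAt_isometry (hmem : ∀ j, H j ∈ harmonicHomogeneous p n)
    (ho : ∀ i j, sphereForm p (H i) (H j) = if i = j then 1 else 0)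
    (R : EuclideanSpace ℝ (Fin p) ≃ₗᵢ[ℝ] EuclideanSpace ℝ (Fin p)) (x y) :
    ∑ j, evalAt (H j) (R x) * evalAt (H j) (R y) = ∑ j, evalAt (H j) x * evalAt (H j) y := by
  choose A hA using fun i =>
    exists_eq_sum_smul hmem ho (rotate_mem_harmonicHomogeneous R (hmem i))
  have h1 : Matrix.of A * (Matrix.of A).transpose = 1 := by
    ext i k
    have h := sphereForm_rotate R (H i) (H k)
    rw [hA, hA, sphereForm_sum_smul ho, ho] at h
    simpa [Matrix.mul_apply, Matrix.one_apply] using h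
  have h2 : (Matrix.of A).transpose * Matrix.of A = 1 := mul_eq_one_comm.mp h1
  have h3 : ∀ i z, evalAt (H i) (R z) = (Matrix.of A).mulVec (fun j => evalAt (H j) z) i := by
    intro i z
    rw [← evalAt_rotate, hA]
    simp [evalAt, Matrix.mulVec, dotProduct]
  simp only [h3]
  change (Matrix.of A).mulVec _ ⬝ᵥ (Matrix.of A).mulVec _ = _
  rw [Matrix.dotProduct_mulVec, ← Matrix.mulVec_transpose, Matrix.mulVec_mulVec, h2,
    Matrix.one_mulVec]
  rfl
end

lemma exists_isometry_eq {E : Type*} [NormedAddCommGroup E] [InnerProductSpace ℝ E] {x y : E}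
    (h : ‖x‖ = ‖y‖) : ∃ R : E ≃ₗᵢ[ℝ] E, R x = y :=
  ⟨Submodule.reflection (ℝ ∙ (x - y))ᗮ, Submodule.reflection_sub h⟩

lemma exists_isLegendrePolynomial (p n : ℕ) [NeZero p] (hpn : 2 ≤ p ∨ n ≤ 1) :
    ∃ P, IsLegendrePolynomial p n P := by
  obtain ⟨a, ha⟩ := exists_isLegendreHarmonic_zonalPoly (p := p) n hpn
  refine ⟨∑ k ∈ Finset.range (n / 2 + 1), Polynomial.C (a k) *
    (Polynomial.X ^ (n - 2 * k) * (1 - Polynomial.X ^ 2) ^ k), _, ha, fun ξ => ?_⟩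
  rw [evalAt_zonalPoly, inner_northPole, norm_eq_of_mem_sphere]
  simp [Polynomial.eval_finsetSum]

lemma IsLegendreHarmonic.numHarmonics_pos {p n : ℕ} [NeZero p] {L : MvPolynomial (Fin p) ℝ}
    (hL : IsLegendreHarmonic p n L) : 0 < numHarmonics p n := by
  have hne : (⟨L, hL.1⟩ : harmonicHomogeneous p n) ≠ 0 := by
    intro h
    have h' : L = 0 := congrArg Subtype.val h
    have := hL.2.1
    simp [h', evalAt] at this
  exact Module.finrank_pos_iff_exists_ne_zero.mpr ⟨_, hne⟩

/-- The reproducing kernel on the diagonal is constant, and its integral is the dimension. -/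
lemma surfaceArea_mul_sum_sq {p n : ℕ} [NeZero p]
    {H : Fin (numHarmonics p n) → MvPolynomial (Fin p) ℝ}
    (hmem : ∀ j, H j ∈ harmonicHomogeneous p n)
    (ho : ∀ i j, sphereForm p (H i) (H j) = if i = j then 1 else 0) :
    surfaceArea p * ∑ j, evalAt (H j) (northPole p) * evalAt (H j) (northPole p) =
      numHarmonics p n := by
  have hconst : ∀ ξ : UnitSphere p, ∑ j, evalAt (H j) ξ * evalAt (H j) ξ =
      ∑ j, evalAt (H j) (northPole p) * evalAt (H j) (northPole p) := by
    intro ξ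
    obtain ⟨R, hR⟩ := exists_isometry_eq (x := (ξ : EuclideanSpace ℝ (Fin p)))
      (y := northPole p) (by rw [norm_eq_of_mem_sphere, norm_northPole])
    rw [← sum_evalAt_mul_evalAt_isometry hmem ho R, hR]
  have hint : ∑ j, sphereForm p (H j) (H j) = numHarmonics p n := by simp [ho]
  rw [← hint]
  simp only [sphereForm_apply]
  rw [← MeasureTheory.integral_finsetSum]
  · simp only [hconst]
    rw [MeasureTheory.integral_const, smul_eq_mul, surfaceArea]
  · intro j _
    simpa [evalAt] using integrable_evalAt (H j * H j)

end

/-! ### The addition theorem -/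

theorem mainTheorem4 (p n : ℕ) [NeZero p] (hpn : 2 ≤ p ∨ n ≤ 1)
    (Y : Fin (numHarmonics p n) → UnitSphere p → ℝ) (hY : IsOrthonormalHarmonics p n Y) :
    (∃ P : Polynomial ℝ, IsLegendrePolynomial p n P) ∧
      ∀ P : Polynomial ℝ, IsLegendrePolynomial p n P →
        ∀ ξ η : UnitSphere p,
          P.eval (inner ℝ (ξ : EuclideanSpace ℝ (Fin p)) (η : EuclideanSpace ℝ (Fin p))) =
            surfaceArea p / (numHarmonics p n : ℝ) * ∑ j, Y j ξ * Y j η := by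
  refine ⟨exists_isLegendrePolynomial p n hpn, ?_⟩
  rintro P ⟨L, hL, hLP⟩ ξ η
  choose H hmem hYH using hY.1
  have ho : ∀ i j, sphereForm p (H i) (H j) = if i = j then 1 else 0 := by
    intro i j
    rw [sphereForm_apply, ← hY.2 i j]
    simp only [hYH]
  have harea := surfaceArea_mul_sum_sq hmem ho
  have hN : (numHarmonics p n : ℝ) ≠ 0 := by exact_mod_cast hL.numHarmonics_pos.ne'
  -- The kernel with one argument at the pole, normalised to be `1` there, is `L`.
  have hker : ∀ x, evalAt ((surfaceArea p / numHarmonics p n) •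
      ∑ j, evalAt (H j) (northPole p) • H j) x =
      surfaceArea p / numHarmonics p n * ∑ j, evalAt (H j) (northPole p) * evalAt (H j) x := by
    intro x
    simp [evalAt]
  have hK : IsLegendreHarmonic p n ((surfaceArea p / numHarmonics p n) •
      ∑ j, evalAt (H j) (northPole p) • H j) := by
    refine ⟨Submodule.smul_mem _ _ (Submodule.sum_mem _ fun j _ =>
      Submodule.smul_mem _ _ (hmem j)), ?_, fun R hR x => ?_⟩
    · rw [hker, div_mul_eq_mul_div, harea, div_self hN]
    · rw [hker, hker, ← sum_evalAt_mul_evalAt_isometry hmem ho R (northPole p) x, hR]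
  obtain ⟨R, hR⟩ := exists_isometry_eq (x := (η : EuclideanSpace ℝ (Fin p)))
    (y := northPole p) (by rw [norm_eq_of_mem_sphere, norm_northPole])
  have hPL := hLP (sphereMap R ξ)
  rw [show ((sphereMap R ξ : UnitSphere p) : EuclideanSpace ℝ (Fin p)) = R ξ from rfl, ← hR,
    R.inner_map_map] at hPL
  rw [← hPL, hL.unique hK, hker, ← hR, sum_evalAt_mul_evalAt_isometry hmem ho]
  simp only [hYH, mul_comm]
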